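/- Let $A$ be a Hermitian operator on $\mathbb{C}^4$ with eigenvalues $a_1<a_2<a_3<a_4$, and let $\psi$ be a Haar-distributed random pure state, i.e. a uniformly distributed random unit vector of $\mathbb{C}^4$. Put $\langle A\rangle_\psi=\langle\psi|A|\psi\rangle$, $\langle A^2\rangle_\psi=\langle\psi|A^2|\psi\rangle$, $V_4(a)=\prod_{1\le i<j\le4}(a_j-a_i)$, $\varphi_{i,j}(r)=(a_i+a_j)r-a_ia_j$ and $$c=\frac{a_2a_4-a_1a_3}{a_2+a_4-a_1-a_3}.$$ Then the pair $(\langle A\rangle_\psi,\langle A^2\rangle_\psi)$ has a joint probability density with respect to Lebesgue measure on $\mathbb{R}^2$, and it is given by $$f(r,s)=\frac{6}{V_4(a)}\,g(r,s)\ge 0,$$ where $$g(r,s)=\begin{cases} (a_4-a_3)(s-\varphi_{1,2}(r)), & (r,s)\in D^{(1)}_1\cup D^{(2)}_2,\\ (a_4-a_1)(s-\varphi_{2,3}(r)), & (r,s)\in D^{(2)}_1\cup D^{(2)}_4,\\ (a_2-a_1)(s-\varphi_{3,4}(r)), & (r,s)\in D^{(2)}_5\cup D^{(3)}_1,\\ (a_2-a_3)(s-\varphi_{1,4}(r)),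 & (r,s)\in D^{(1)}_2\cup D^{(2)}_3\cup D^{(2)}_6\cup D^{(3)}_2, \end{cases}$$ (the formulas agree wherever these closed regions overlap) and $f(r,s)=0$ outside the union of the ten regions $$\begin{aligned} D^{(1)}_1&=\{a_1\le r\le a_2,\ \varphi_{1,2}(r)\le s\le\varphi_{1,3}(r)\}, & D^{(1)}_2&=\{a_1\le r\le a_2,\ \varphi_{1,3}(r)\le s\le\varphi_{1,4}(r)\},\\ D^{(2)}_1&=\{a_2\le r\le c,\ \varphi_{2,3}(r)\le s\le\varphi_{2,4}(r)\}, & D^{(2)}_2&=\{a_2\le r\le c,\ \varphi_{2,4}(r)\le s\le\varphi_{1,3}(r)\},\\ D^{(2)}_3&=\{a_2\le r\le c,\ \varphi_{1,3}(r)\le s\le\varphi_{1,4}(r)\}, & D^{(2)}_4&=\{c\le r\le a_3,\ \varphi_{2,3}(r)\le s\le\varphi_{1,3}(r)\},\\ D^{(2)}_5&=\{c\le r\le a_3,\ \varphi_{1,3}(r)\le s\le\varphi_{2,4}(r)\}, & D^{(2)}_6&=\{c\le r\le a_3,\ \varphi_{2,4}(r)\le s\le\varphi_{1,4}(r)\},\\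 D^{(3)}_1&=\{a_3\le r\le a_4,\ \varphi_{3,4}(r)\le s\le\varphi_{2,4}(r)\}, & D^{(3)}_2&=\{a_3\le r\le a_4,\ \varphi_{2,4}(r)\le s\le\varphi_{1,4}(r)\}. \end{aligned}$$ -/

import Mathlib

open MeasureTheory ProbabilityTheory

noncomputable section

namespace QuditPDF

/-- The unit sphere of `ℂ ^ d`: the state vectors of pure qudit states. -/
abbrev PureState (d : ℕ) : Type := Metric.sphere (0 : EuclideanSpace ℂ (Fin d)) 1

/-- The law of a Haar-distributed random pure state on `ℂ ^ d`: the surface measure of the unit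
sphere (for the Lebesgue measure of `ℂ ^ d ≅ ℝ ^ (2 * d)`), normalised to total mass one. -/
def haarPureState (d : ℕ) : Measure (PureState d) :=
  ((volume : Measure (EuclideanSpace ℂ (Fin d))).toSphere Set.univ)⁻¹ •
    (volume : Measure (EuclideanSpace ℂ (Fin d))).toSphere

/-- The expectation value `⟨ψ|A|ψ⟩`. The sesquilinear form is real for Hermitian `A`; for an
arbitrary matrix this is its real part. -/
def expVal {d : ℕ} (A : Matrix (Fin d) (Fin d) ℂ) (ψ : PureState d) : ℝ :=
  (inner ℂ (ψ : EuclideanSpace ℂ (Fin d)) (Matrix.toEuclideanLin A ψ)).re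

/-- The random pair `(⟨A⟩, ⟨A ^ 2⟩)`. -/
def expPair {d : ℕ} (A : Matrix (Fin d) (Fin d) ℂ) (ψ : PureState d) : ℝ × ℝ :=
  (expVal A ψ, expVal (A ^ 2) ψ)

/-- The chord `φ(r) = (x + y) r - x y`, through `(x, x ^ 2)` and `(y, y ^ 2)`. -/
def chord (x y r : ℝ) : ℝ := (x + y) * r - x * y

/-- The Vandermonde product `∏_{i < j} (a_j - a_i)` of four numbers. -/
def vandermonde4 (a₁ a₂ a₃ a₄ : ℝ) : ℝ :=
  (a₂ - a₁) * (a₃ - a₁) * (a₄ - a₁) * (a₃ - a₂) * (a₄ - a₂) * (a₄ - a₃)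

/-- The abscissa of the intersection of the chords `φ₁₃` and `φ₂₄`. -/
def crossing (a₁ a₂ a₃ a₄ : ℝ) : ℝ := (a₂ * a₄ - a₁ * a₃) / (a₂ + a₄ - a₁ - a₃)

/-! The ten closed regions, as sets of pairs `(r, s)`; in `regionDij`, `i` is the number of the
interval `[aᵢ, aᵢ₊₁]` containing `r`, and `j` the number of the region within that strip. -/

def regionD11 (a₁ a₂ a₃ _a₄ : ℝ) : Set (ℝ × ℝ) :=
  {p | a₁ ≤ p.1 ∧ p.1 ≤ a₂ ∧ chord a₁ a₂ p.1 ≤ p.2 ∧ p.2 ≤ chord a₁ a₃ p.1}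

def regionD12 (a₁ a₂ a₃ a₄ : ℝ) : Set (ℝ × ℝ) :=
  {p | a₁ ≤ p.1 ∧ p.1 ≤ a₂ ∧ chord a₁ a₃ p.1 ≤ p.2 ∧ p.2 ≤ chord a₁ a₄ p.1}

def regionD21 (a₁ a₂ a₃ a₄ : ℝ) : Set (ℝ × ℝ) :=
  {p | a₂ ≤ p.1 ∧ p.1 ≤ crossing a₁ a₂ a₃ a₄ ∧
    chord a₂ a₃ p.1 ≤ p.2 ∧ p.2 ≤ chord a₂ a₄ p.1}

def regionD22 (a₁ a₂ a₃ a₄ : ℝ) : Set (ℝ × ℝ) :=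
  {p | a₂ ≤ p.1 ∧ p.1 ≤ crossing a₁ a₂ a₃ a₄ ∧
    chord a₂ a₄ p.1 ≤ p.2 ∧ p.2 ≤ chord a₁ a₃ p.1}

def regionD23 (a₁ a₂ a₃ a₄ : ℝ) : Set (ℝ × ℝ) :=
  {p | a₂ ≤ p.1 ∧ p.1 ≤ crossing a₁ a₂ a₃ a₄ ∧
    chord a₁ a₃ p.1 ≤ p.2 ∧ p.2 ≤ chord a₁ a₄ p.1}

def regionD24 (a₁ a₂ a₃ a₄ : ℝ) : Set (ℝ × ℝ) :=
  {p | crossing a₁ a₂ a₃ a₄ ≤ p.1 ∧ p.1 ≤ a₃ ∧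
    chord a₂ a₃ p.1 ≤ p.2 ∧ p.2 ≤ chord a₁ a₃ p.1}

def regionD25 (a₁ a₂ a₃ a₄ : ℝ) : Set (ℝ × ℝ) :=
  {p | crossing a₁ a₂ a₃ a₄ ≤ p.1 ∧ p.1 ≤ a₃ ∧
    chord a₁ a₃ p.1 ≤ p.2 ∧ p.2 ≤ chord a₂ a₄ p.1}

def regionD26 (a₁ a₂ a₃ a₄ : ℝ) : Set (ℝ × ℝ) :=
  {p | crossing a₁ a₂ a₃ a₄ ≤ p.1 ∧ p.1 ≤ a₃ ∧
    chord a₂ a₄ p.1 ≤ p.2 ∧ p.2 ≤ chord a₁ a₄ p.1}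

def regionD31 (_a₁ a₂ a₃ a₄ : ℝ) : Set (ℝ × ℝ) :=
  {p | a₃ ≤ p.1 ∧ p.1 ≤ a₄ ∧ chord a₃ a₄ p.1 ≤ p.2 ∧ p.2 ≤ chord a₂ a₄ p.1}

def regionD32 (a₁ a₂ a₃ a₄ : ℝ) : Set (ℝ × ℝ) :=
  {p | a₃ ≤ p.1 ∧ p.1 ≤ a₄ ∧ chord a₂ a₄ p.1 ≤ p.2 ∧ p.2 ≤ chord a₁ a₄ p.1}

/-- The union of the regions on which `g` is `(a₄ - a₃) (s - φ₁₂(r))`. -/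
def piece12 (a₁ a₂ a₃ a₄ : ℝ) : Set (ℝ × ℝ) :=
  regionD11 a₁ a₂ a₃ a₄ ∪ regionD22 a₁ a₂ a₃ a₄

/-- The union of the regions on which `g` is `(a₄ - a₁) (s - φ₂₃(r))`. -/
def piece23 (a₁ a₂ a₃ a₄ : ℝ) : Set (ℝ × ℝ) :=
  regionD21 a₁ a₂ a₃ a₄ ∪ regionD24 a₁ a₂ a₃ a₄

/-- The union of the regions on which `g` is `(a₂ - a₁) (s - φ₃₄(r))`. -/
def piece34 (a₁ a₂ a₃ a₄ : ℝ) : Set (ℝ × ℝ) :=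
  regionD25 a₁ a₂ a₃ a₄ ∪ regionD31 a₁ a₂ a₃ a₄

/-- The union of the regions on which `g` is `(a₂ - a₃) (s - φ₁₄(r))`. -/
def piece14 (a₁ a₂ a₃ a₄ : ℝ) : Set (ℝ × ℝ) :=
  regionD12 a₁ a₂ a₃ a₄ ∪ regionD23 a₁ a₂ a₃ a₄ ∪ regionD26 a₁ a₂ a₃ a₄ ∪
    regionD32 a₁ a₂ a₃ a₄

open Classical in
/-- The piecewise linear function `g(r, s)`, extended by zero outside the ten regions. Where pieces
overlap (along their common boundaries) the first applicable clause is taken. -/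
def g (a₁ a₂ a₃ a₄ : ℝ) (p : ℝ × ℝ) : ℝ :=
  if p ∈ piece12 a₁ a₂ a₃ a₄ then (a₄ - a₃) * (p.2 - chord a₁ a₂ p.1)
  else if p ∈ piece23 a₁ a₂ a₃ a₄ then (a₄ - a₁) * (p.2 - chord a₂ a₃ p.1)
  else if p ∈ piece34 a₁ a₂ a₃ a₄ then (a₂ - a₁) * (p.2 - chord a₃ a₄ p.1)
  else if p ∈ piece14 a₁ a₂ a₃ a₄ then (a₂ - a₃) * (p.2 - chord a₁ a₄ p.1)
  else 0

/-- The claimed joint density `6 / V₄(a) * g(r, s)`. -/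
def jointDensity (a₁ a₂ a₃ a₄ : ℝ) (p : ℝ × ℝ) : ℝ :=
  6 / vandermonde4 a₁ a₂ a₃ a₄ * g a₁ a₂ a₃ a₄ p

end QuditPDF

end

/-! In an eigenbasis of `A` the pair depends only on the weights `|ψᵢ|²`. Surface measure on the
sphere is, up to a constant, the volume of truncated cones, and `z ↦ |z|²` sends Lebesgue measure on
`ℂ` to `π` times Lebesgue measure on the half-line. The law is thus a ratio of volumes of sets of
positive weights `y` with total mass below one (`haarPureState_expPair_preimage`,
`map_norm_sq_volume_pi`).

The linear map `y ↦ (∑ yᵢ, ∑ aᵢ yᵢ, ∑ aᵢ² yᵢ, y₄)` and scaling by the mass reduce this to the length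
of a fibre: given `(r, s)`, which `t = y₄` are admissible at mass one? Since `s - φᵢⱼ(r) = ∑ₖ yₖ (aₖ
- aᵢ)(aₖ - aⱼ)` involves only two weights, each positivity condition bounds `t` on one side: two
lower bounds `0, l` and two upper bounds `u, v`. The length is the positive part of the least of
`u`, `v`, `v - l`, `u - l`, which over a common denominator are the four affine forms in `g`
(`volume_regionBetween_weights`).

So `g` should be a truncated minimum of four affine forms (`g_eq_gMin`); the ten regions record
which form is least. -/

noncomputable section

namespace QuditPDF

open scoped ENNReal Pointwise

variable {a₁ a₂ a₃ a₄ : ℝ}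

/-! ### The piecewise linear function as a truncated minimum -/

/-- The minimum of the four affine functions defining `g`, truncated at zero. -/
def gMin (a₁ a₂ a₃ a₄ : ℝ) (p : ℝ × ℝ) : ℝ :=
  max 0 (min (min ((a₄ - a₃) * (p.2 - chord a₁ a₂ p.1)) ((a₄ - a₁) * (p.2 - chord a₂ a₃ p.1)))
    (min ((a₂ - a₁) * (p.2 - chord a₃ a₄ p.1)) ((a₂ - a₃) * (p.2 - chord a₁ a₄ p.1))))

lemma crossing_mul (h : 0 < a₂ + a₄ - a₁ - a₃) :
    crossing a₁ a₂ a₃ a₄ * (a₂ + a₄ - a₁ - a₃) = a₂ * a₄ - a₁ * a₃ := by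
  unfold crossing
  field_simp

lemma chord_le_chord_iff_le_crossing (h₁₂ : a₁ < a₂) (h₃₄ : a₃ < a₄) (r : ℝ) :
    chord a₂ a₄ r ≤ chord a₁ a₃ r ↔ r ≤ crossing a₁ a₂ a₃ a₄ := by
  have h : 0 < a₂ + a₄ - a₁ - a₃ := by linarith
  have hc := crossing_mul h
  have : chord a₂ a₄ r - chord a₁ a₃ r
      = (r - crossing a₁ a₂ a₃ a₄) * (a₂ + a₄ - a₁ - a₃) := by
    unfold chord; linear_combination hc
  constructor
  · intro h1
    by_contra! h2
    nlinarith [mul_pos (sub_pos.2 h2) h]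
  · intro h1
    nlinarith [mul_nonneg (sub_nonneg.2 h1) h.le]

lemma crossing_mem (h₁₂ : a₁ < a₂) (h₂₃ : a₂ < a₃) (h₃₄ : a₃ < a₄) :
    a₂ ≤ crossing a₁ a₂ a₃ a₄ ∧ crossing a₁ a₂ a₃ a₄ ≤ a₃ := by
  have h : 0 < a₂ + a₄ - a₁ - a₃ := by linarith
  unfold crossing
  rw [le_div_iff₀ h, div_le_iff₀ h]
  constructor <;> nlinarith [mul_pos (sub_pos.2 h₁₂) (sub_pos.2 h₂₃),
    mul_pos (sub_pos.2 h₂₃) (sub_pos.2 h₃₄)]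

lemma gMin_eq {x : ℝ} {p : ℝ × ℝ} (h0 : 0 ≤ x)
    (h₁ : x ≤ (a₄ - a₃) * (p.2 - chord a₁ a₂ p.1)) (h₂ : x ≤ (a₄ - a₁) * (p.2 - chord a₂ a₃ p.1))
    (h₃ : x ≤ (a₂ - a₁) * (p.2 - chord a₃ a₄ p.1)) (h₄ : x ≤ (a₂ - a₃) * (p.2 - chord a₁ a₄ p.1))
    (h : x = (a₄ - a₃) * (p.2 - chord a₁ a₂ p.1) ∨ x = (a₄ - a₁) * (p.2 - chord a₂ a₃ p.1) ∨
      x = (a₂ - a₁) * (p.2 - chord a₃ a₄ p.1) ∨ x = (a₂ - a₃) * (p.2 - chord a₁ a₄ p.1)) :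
    gMin a₁ a₂ a₃ a₄ p = x := by
  unfold gMin
  apply le_antisymm
  · apply max_le h0
    rcases h with h | h | h | h
    · exact (min_le_left _ _).trans ((min_le_left _ _).trans h.ge)
    · exact (min_le_left _ _).trans ((min_le_right _ _).trans h.ge)
    · exact (min_le_right _ _).trans ((min_le_left _ _).trans h.ge)
    · exact (min_le_right _ _).trans ((min_le_right _ _).trans h.ge)
  · exact le_max_of_le_right (le_min (le_min h₁ h₂) (le_min h₃ h₄))

/-- These three identities settle every comparison between the four forms. The last two share their
right-hand side, so form 12 + form 34 = form 14 + form 23, and the signs of `s - φ₂₄(r)` and `s -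
φ₁₃(r)` alone decide which form is least. -/
lemma form23_sub_form12 (r s : ℝ) : (a₄ - a₁) * (s - chord a₂ a₃ r) -
    (a₄ - a₃) * (s - chord a₁ a₂ r) = (a₃ - a₁) * (s - chord a₂ a₄ r) := by
  unfold chord; ring

lemma form34_sub_form23 (r s : ℝ) : (a₂ - a₁) * (s - chord a₃ a₄ r) -
    (a₄ - a₁) * (s - chord a₂ a₃ r) = (a₄ - a₂) * (chord a₁ a₃ r - s) := by
  unfold chord; ring

lemma form14_sub_form12 (r s : ℝ) : (a₂ - a₃) * (s - chord a₁ a₄ r) -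
    (a₄ - a₃) * (s - chord a₁ a₂ r) = (a₄ - a₂) * (chord a₁ a₃ r - s) := by
  unfold chord; ring

lemma gMin_eq_form12 (h₁₂ : a₁ < a₂) (h₂₃ : a₂ < a₃) (h₃₄ : a₃ < a₄) {p : ℝ × ℝ}
    (h0 : chord a₁ a₂ p.1 ≤ p.2) (h₁ : chord a₂ a₄ p.1 ≤ p.2) (h₂ : p.2 ≤ chord a₁ a₃ p.1) :
    gMin a₁ a₂ a₃ a₄ p = (a₄ - a₃) * (p.2 - chord a₁ a₂ p.1) := by
  have e₁ := form23_sub_form12 (a₁ := a₁) (a₂ := a₂) (a₃ := a₃) (a₄ := a₄) p.1 p.2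
  have e₂ := form34_sub_form23 (a₁ := a₁) (a₂ := a₂) (a₃ := a₃) (a₄ := a₄) p.1 p.2
  have e₃ := form14_sub_form12 (a₁ := a₁) (a₂ := a₂) (a₃ := a₃) (a₄ := a₄) p.1 p.2
  have k₁ := mul_nonneg (show 0 ≤ a₃ - a₁ by linarith) (sub_nonneg.2 h₁)
  have k₂ := mul_nonneg (show 0 ≤ a₄ - a₂ by linarith) (sub_nonneg.2 h₂)
  have k₃ := mul_nonneg (show 0 ≤ a₄ - a₃ by linarith) (sub_nonneg.2 h0)
  apply gMin_eq <;> first | linarith | tauto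

lemma gMin_eq_form23 (h₁₂ : a₁ < a₂) (h₂₃ : a₂ < a₃) (h₃₄ : a₃ < a₄) {p : ℝ × ℝ}
    (h0 : chord a₂ a₃ p.1 ≤ p.2) (h₁ : p.2 ≤ chord a₂ a₄ p.1) (h₂ : p.2 ≤ chord a₁ a₃ p.1) :
    gMin a₁ a₂ a₃ a₄ p = (a₄ - a₁) * (p.2 - chord a₂ a₃ p.1) := by
  have e₁ := form23_sub_form12 (a₁ := a₁) (a₂ := a₂) (a₃ := a₃) (a₄ := a₄) p.1 p.2
  have e₂ := form34_sub_form23 (a₁ := a₁) (a₂ := a₂) (a₃ := a₃) (a₄ := a₄) p.1 p.2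
  have e₃ := form14_sub_form12 (a₁ := a₁) (a₂ := a₂) (a₃ := a₃) (a₄ := a₄) p.1 p.2
  have k₁ := mul_nonneg (show 0 ≤ a₃ - a₁ by linarith) (sub_nonneg.2 h₁)
  have k₂ := mul_nonneg (show 0 ≤ a₄ - a₂ by linarith) (sub_nonneg.2 h₂)
  have k₃ := mul_nonneg (show 0 ≤ a₄ - a₁ by linarith) (sub_nonneg.2 h0)
  apply gMin_eq <;> first | linarith | tauto

lemma gMin_eq_form34 (h₁₂ : a₁ < a₂) (h₂₃ : a₂ < a₃) (h₃₄ : a₃ < a₄) {p : ℝ × ℝ}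
    (h0 : chord a₃ a₄ p.1 ≤ p.2) (h₁ : p.2 ≤ chord a₂ a₄ p.1) (h₂ : chord a₁ a₃ p.1 ≤ p.2) :
    gMin a₁ a₂ a₃ a₄ p = (a₂ - a₁) * (p.2 - chord a₃ a₄ p.1) := by
  have e₁ := form23_sub_form12 (a₁ := a₁) (a₂ := a₂) (a₃ := a₃) (a₄ := a₄) p.1 p.2
  have e₂ := form34_sub_form23 (a₁ := a₁) (a₂ := a₂) (a₃ := a₃) (a₄ := a₄) p.1 p.2
  have e₃ := form14_sub_form12 (a₁ := a₁) (a₂ := a₂) (a₃ := a₃) (a₄ := a₄) p.1 p.2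
  have k₁ := mul_nonneg (show 0 ≤ a₃ - a₁ by linarith) (sub_nonneg.2 h₁)
  have k₂ := mul_nonneg (show 0 ≤ a₄ - a₂ by linarith) (sub_nonneg.2 h₂)
  have k₃ := mul_nonneg (show 0 ≤ a₂ - a₁ by linarith) (sub_nonneg.2 h0)
  apply gMin_eq <;> first | linarith | tauto

lemma gMin_eq_form14 (h₁₂ : a₁ < a₂) (h₂₃ : a₂ < a₃) (h₃₄ : a₃ < a₄) {p : ℝ × ℝ}
    (h0 : p.2 ≤ chord a₁ a₄ p.1) (h₁ : chord a₂ a₄ p.1 ≤ p.2) (h₂ : chord a₁ a₃ p.1 ≤ p.2) :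
    gMin a₁ a₂ a₃ a₄ p = (a₂ - a₃) * (p.2 - chord a₁ a₄ p.1) := by
  have e₁ := form23_sub_form12 (a₁ := a₁) (a₂ := a₂) (a₃ := a₃) (a₄ := a₄) p.1 p.2
  have e₂ := form34_sub_form23 (a₁ := a₁) (a₂ := a₂) (a₃ := a₃) (a₄ := a₄) p.1 p.2
  have e₃ := form14_sub_form12 (a₁ := a₁) (a₂ := a₂) (a₃ := a₃) (a₄ := a₄) p.1 p.2
  have k₁ := mul_nonneg (show 0 ≤ a₃ - a₁ by linarith) (sub_nonneg.2 h₁)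
  have k₂ := mul_nonneg (show 0 ≤ a₄ - a₂ by linarith) (sub_nonneg.2 h₂)
  have k₃ := mul_nonneg (show 0 ≤ a₃ - a₂ by linarith) (sub_nonneg.2 h0)
  apply gMin_eq <;> first | linarith | tauto

/-- Two chords with a common endpoint compare according to the position relative to it. -/
lemma chord_le_chord_of_le {x y z r : ℝ} (hyz : y ≤ z) (hr : x ≤ r) :
    chord x y r ≤ chord x z r := by
  unfold chord; nlinarith [mul_nonneg (sub_nonneg.2 hyz) (sub_nonneg.2 hr)]

lemma chord_le_chord_of_ge {x y z r : ℝ} (hyz : y ≤ z) (hr : r ≤ x) :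
    chord x z r ≤ chord x y r := by
  unfold chord; nlinarith [mul_nonneg (sub_nonneg.2 hyz) (sub_nonneg.2 hr)]

lemma chord_comm (x y r : ℝ) : chord x y r = chord y x r := by
  unfold chord; ring

/-- A region bounds `s` only by the chords of its own strip. The missing inequalities come from the
position of `r` relative to a node shared by two chords; the other pieces also use its position
relative to the crossing. -/
lemma gMin_of_mem_piece12 (h₁₂ : a₁ < a₂) (h₂₃ : a₂ < a₃) (h₃₄ : a₃ < a₄) {p : ℝ × ℝ}
    (hp : p ∈ piece12 a₁ a₂ a₃ a₄) :
    gMin a₁ a₂ a₃ a₄ p = (a₄ - a₃) * (p.2 - chord a₁ a₂ p.1) := by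
  rcases hp with ⟨hl, hr, h, h'⟩ | ⟨hl, hr, h, h'⟩
  · refine gMin_eq_form12 h₁₂ h₂₃ h₃₄ h (le_trans ?_ h) h'
    rw [chord_comm a₁]
    exact chord_le_chord_of_ge (by linarith) hr
  · refine gMin_eq_form12 h₁₂ h₂₃ h₃₄ (le_trans ?_ h) h h'
    rw [chord_comm a₁]
    exact chord_le_chord_of_le (by linarith) hl

lemma gMin_of_mem_piece23 (h₁₂ : a₁ < a₂) (h₂₃ : a₂ < a₃) (h₃₄ : a₃ < a₄) {p : ℝ × ℝ}
    (hp : p ∈ piece23 a₁ a₂ a₃ a₄) :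
    gMin a₁ a₂ a₃ a₄ p = (a₄ - a₁) * (p.2 - chord a₂ a₃ p.1) := by
  rcases hp with ⟨hl, hr, h, h'⟩ | ⟨hl, hr, h, h'⟩
  · exact gMin_eq_form23 h₁₂ h₂₃ h₃₄ h h'
      (h'.trans ((chord_le_chord_iff_le_crossing h₁₂ h₃₄ _).2 hr))
  · refine gMin_eq_form23 h₁₂ h₂₃ h₃₄ h (h'.trans ?_) h'
    have hc := crossing_mul (show 0 < a₂ + a₄ - a₁ - a₃ by linarith)
    unfold chord
    nlinarith [mul_nonneg (sub_nonneg.2 hl) (show 0 ≤ a₂ + a₄ - a₁ - a₃ by linarith)]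

lemma gMin_of_mem_piece34 (h₁₂ : a₁ < a₂) (h₂₃ : a₂ < a₃) (h₃₄ : a₃ < a₄) {p : ℝ × ℝ}
    (hp : p ∈ piece34 a₁ a₂ a₃ a₄) :
    gMin a₁ a₂ a₃ a₄ p = (a₂ - a₁) * (p.2 - chord a₃ a₄ p.1) := by
  rcases hp with ⟨hl, hr, h, h'⟩ | ⟨hl, hr, h, h'⟩
  · refine gMin_eq_form34 h₁₂ h₂₃ h₃₄ (le_trans ?_ h) h' h
    rw [chord_comm a₁]
    exact chord_le_chord_of_ge (by linarith) hr
  · refine gMin_eq_form34 h₁₂ h₂₃ h₃₄ h h' (le_trans ?_ h)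
    rw [chord_comm a₁]
    exact chord_le_chord_of_le (by linarith) hl

lemma gMin_of_mem_piece14 (h₁₂ : a₁ < a₂) (h₂₃ : a₂ < a₃) (h₃₄ : a₃ < a₄) {p : ℝ × ℝ}
    (hp : p ∈ piece14 a₁ a₂ a₃ a₄) :
    gMin a₁ a₂ a₃ a₄ p = (a₂ - a₃) * (p.2 - chord a₁ a₄ p.1) := by
  have hc := crossing_mul (show 0 < a₂ + a₄ - a₁ - a₃ by linarith)
  obtain ⟨hc₁, hc₂⟩ := crossing_mem h₁₂ h₂₃ h₃₄
  have hc0 : 0 ≤ a₂ + a₄ - a₁ - a₃ := by linarith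
  have key : (chord a₂ a₄ p.1 ≤ p.2 ∧ p.1 ≤ crossing a₁ a₂ a₃ a₄ ∨
      crossing a₁ a₂ a₃ a₄ ≤ p.1) := by
    rcases hp with ((⟨hl, hr, h, h'⟩ | ⟨hl, hr, h, h'⟩) | ⟨hl, hr, h, h'⟩) | ⟨hl, hr, h, h'⟩
    · exact Or.inl ⟨((chord_le_chord_iff_le_crossing h₁₂ h₃₄ _).2 (hr.trans hc₁)).trans h, hr.trans hc₁⟩
    · exact Or.inl ⟨((chord_le_chord_iff_le_crossing h₁₂ h₃₄ _).2 hr).trans h, hr⟩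
    · exact Or.inr hl
    · exact Or.inr (hc₂.trans hl)
  have key' : crossing a₁ a₂ a₃ a₄ ≤ p.1 → chord a₁ a₃ p.1 ≤ chord a₂ a₄ p.1 := by
    intro hl
    unfold chord
    nlinarith [mul_nonneg (sub_nonneg.2 hl) hc0]
  rcases hp with ((⟨hl, hr, h, h'⟩ | ⟨hl, hr, h, h'⟩) | ⟨hl, hr, h, h'⟩) | ⟨hl, hr, h, h'⟩
  · exact gMin_eq_form14 h₁₂ h₂₃ h₃₄ h'
      (((chord_le_chord_iff_le_crossing h₁₂ h₃₄ _).2 (hr.trans hc₁)).trans h) h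
  · exact gMin_eq_form14 h₁₂ h₂₃ h₃₄ h' (((chord_le_chord_iff_le_crossing h₁₂ h₃₄ _).2 hr).trans h) h
  · exact gMin_eq_form14 h₁₂ h₂₃ h₃₄ h' h ((key' hl).trans h)
  · exact gMin_eq_form14 h₁₂ h₂₃ h₃₄ h' h ((key' (hc₂.trans hl)).trans h)

lemma gMin_of_notMem (h₁₂ : a₁ < a₂) (h₂₃ : a₂ < a₃) (h₃₄ : a₃ < a₄) {p : ℝ × ℝ}
    (hp₁ : p ∉ piece12 a₁ a₂ a₃ a₄) (hp₂ : p ∉ piece23 a₁ a₂ a₃ a₄)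
    (hp₃ : p ∉ piece34 a₁ a₂ a₃ a₄) (hp₄ : p ∉ piece14 a₁ a₂ a₃ a₄) :
    gMin a₁ a₂ a₃ a₄ p = 0 := by
  unfold gMin
  rw [max_eq_left_iff]
  by_contra! h
  simp only [lt_min_iff] at h
  obtain ⟨⟨k₁, k₂⟩, k₃, k₄⟩ := h
  replace k₁ := sub_pos.1 (pos_of_mul_pos_right k₁ (by linarith))
  replace k₂ := sub_pos.1 (pos_of_mul_pos_right k₂ (by linarith))
  replace k₃ := sub_pos.1 (pos_of_mul_pos_right k₃ (by linarith))
  replace k₄ : p.2 < chord a₁ a₄ p.1 := by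
    by_contra! h
    nlinarith [mul_nonneg (sub_nonneg.2 h₂₃.le) (sub_nonneg.2 h)]
  -- Outside `[a₁, a₄]` the chord `φ₁₄` lies below `φ₁₂` (on the left) or `φ₃₄` (on the right), so
  -- `s` cannot lie between them.
  have r₁ : a₁ < p.1 := by
    by_contra! h
    have := chord_le_chord_of_ge (show a₂ ≤ a₄ by linarith) h
    linarith
  have r₄ : p.1 < a₄ := by
    by_contra! h
    have := chord_le_chord_of_le (show a₁ ≤ a₃ by linarith) h
    rw [chord_comm, chord_comm a₄] at this
    linarith
  obtain ⟨hc₁, hc₂⟩ := crossing_mem h₁₂ h₂₃ h₃₄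
  simp only [piece12, piece23, piece34, piece14, Set.mem_union, not_or, regionD11, regionD12,
    regionD21, regionD22, regionD23, regionD24, regionD25, regionD26, regionD31, regionD32,
    Set.mem_ofPred_eq] at hp₁ hp₂ hp₃ hp₄
  -- Pure order reasoning remains: comparing `r` with `a₂`, `c`, `a₃` and `s` with `φ₁₃`, `φ₂₄`
  -- places `p` in one of the ten regions.
  grind

lemma g_eq_gMin (h₁₂ : a₁ < a₂) (h₂₃ : a₂ < a₃) (h₃₄ : a₃ < a₄) :
    g a₁ a₂ a₃ a₄ = gMin a₁ a₂ a₃ a₄ := by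
  funext p
  unfold g
  split_ifs with k₁ k₂ k₃ k₄
  · exact (gMin_of_mem_piece12 h₁₂ h₂₃ h₃₄ k₁).symm
  · exact (gMin_of_mem_piece23 h₁₂ h₂₃ h₃₄ k₂).symm
  · exact (gMin_of_mem_piece34 h₁₂ h₂₃ h₃₄ k₃).symm
  · exact (gMin_of_mem_piece14 h₁₂ h₂₃ h₃₄ k₄).symm
  · exact (gMin_of_notMem h₁₂ h₂₃ h₃₄ k₁ k₂ k₃ k₄).symm

lemma vandermonde4_pos (h₁₂ : a₁ < a₂) (h₂₃ : a₂ < a₃) (h₃₄ : a₃ < a₄) :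
    0 < vandermonde4 a₁ a₂ a₃ a₄ := by
  unfold vandermonde4
  have := sub_pos.2 h₁₂
  have := sub_pos.2 h₂₃
  have := sub_pos.2 h₃₄
  have := sub_pos.2 (h₁₂.trans h₂₃)
  have := sub_pos.2 (h₂₃.trans h₃₄)
  have := sub_pos.2 ((h₁₂.trans h₂₃).trans h₃₄)
  positivity

/-! ### Squared moduli of complex coordinates -/

/-- The squared modulus pushes Lebesgue measure on `ℂ` forward to `π` times Lebesgue measure on
the positive half-line. -/
lemma map_norm_sq_volume :
    (volume : Measure ℂ).map (fun z => ‖z‖ ^ 2)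
      = NNReal.pi • (volume : Measure ℝ).restrict (Set.Ioi 0) := by
  have hm : Measurable fun z : ℂ => ‖z‖ ^ 2 := by fun_prop
  symm
  -- The preimage of an interval is empty, a disc or an annulus, of area `π` times the length of the
  -- positive part of the interval.
  apply Real.measure_ext_Ioo_rat
  intro a b
  rw [Measure.smul_apply, Measure.restrict_apply measurableSet_Ioo,
    Measure.map_apply hm measurableSet_Ioo, Set.Ioo_inter_Ioi, Real.volume_Ioo]
  generalize (a : ℝ) = a
  generalize (b : ℝ) = b
  rcases le_or_gt b 0 with hb | hb
  · have h : (fun z : ℂ => ‖z‖ ^ 2) ⁻¹' Set.Ioo a b = ∅ := by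
      ext z
      simp only [Set.mem_preimage, Set.mem_Ioo, Set.mem_empty_iff_false, iff_false, not_and,
        not_lt]
      intro _
      exact hb.trans (sq_nonneg ‖z‖)
    rw [h, measure_empty, ENNReal.ofReal_of_nonpos, smul_zero]
    linarith [le_max_right a 0]
  rcases lt_or_ge a 0 with ha | ha
  · have h : (fun z : ℂ => ‖z‖ ^ 2) ⁻¹' Set.Ioo a b = Metric.ball 0 (√b) := by
      ext z
      simp [Real.lt_sqrt (norm_nonneg z), ha.trans_le (sq_nonneg ‖z‖)]
    rw [h, Complex.volume_ball, max_eq_right ha.le, sub_zero, ← ENNReal.ofReal_pow (by positivity),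
      Real.sq_sqrt hb.le, mul_comm]
    rfl
  · rw [max_eq_left ha]
    rcases le_or_gt b a with hab | hab
    · rw [Set.Ioo_eq_empty (not_lt.2 hab), ENNReal.ofReal_of_nonpos (by linarith)]
      simp
    have h : (fun z : ℂ => ‖z‖ ^ 2) ⁻¹' Set.Ioo a b
        = Metric.ball 0 (√b) \ Metric.closedBall 0 (√a) := by
      ext z
      simp [Real.lt_sqrt (norm_nonneg z), Real.sqrt_lt ha (norm_nonneg z), and_comm]
    have hsub : Metric.closedBall (0 : ℂ) (√a) ⊆ Metric.ball 0 (√b) :=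
      Metric.closedBall_subset_ball (Real.sqrt_lt_sqrt ha hab)
    rw [h, measure_sdiff hsub measurableSet_closedBall.nullMeasurableSet
      (measure_closedBall_lt_top).ne, Complex.volume_ball, Complex.volume_closedBall,
      ← ENNReal.ofReal_pow (by positivity), ← ENNReal.ofReal_pow (by positivity),
      Real.sq_sqrt hb.le, Real.sq_sqrt ha, ← ENNReal.sub_mul (by simp), ← ENNReal.ofReal_sub _ ha,
      mul_comm]
    rfl

lemma map_norm_sq_volume_pi :
    (volume : Measure (Fin 4 → ℂ)).map (fun z i => ‖z i‖ ^ 2)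
      = NNReal.pi ^ 4 •
        (volume : Measure (Fin 4 → ℝ)).restrict (Set.univ.pi fun _ => Set.Ioi 0) := by
  have : SigmaFinite ((volume : Measure ℂ).map (fun z => ‖z‖ ^ 2)) := by
    rw [map_norm_sq_volume]; infer_instance
  rw [volume_pi, Measure.pi_map_pi (f := fun _ z => ‖z‖ ^ 2) (by fun_prop)]
  simp only [map_norm_sq_volume]
  apply Measure.pi_eq
  intro s hs
  rw [volume_pi, Measure.restrict_pi_pi, Measure.smul_apply, Measure.pi_pi]
  simp only [Measure.smul_apply, ENNReal.smul_def, smul_eq_mul, Finset.prod_mul_distrib,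
    Finset.prod_const, Finset.card_univ, Fintype.card_fin]
  simp

/-! ### Cones and fibre lengths -/

/-- The nesting separates the cone height, the base point `(r, s)` and the fibre variable `t`, as
`volume_cone` and `regionBetween` require. -/
lemma measurePreserving_vec4 :
    MeasurePreserving (fun q : ℝ × ((ℝ × ℝ) × ℝ) => (![q.1, q.2.1.1, q.2.1.2, q.2.2] : Fin 4 → ℝ))
      volume volume := by
  have hm : Measurable
      (fun q : ℝ × ((ℝ × ℝ) × ℝ) => (![q.1, q.2.1.1, q.2.1.2, q.2.2] : Fin 4 → ℝ)) := by
    rw [measurable_pi_iff]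
    intro i
    fin_cases i <;> simp <;> fun_prop
  refine ⟨hm, ?_⟩
  rw [volume_pi]
  symm
  apply Measure.pi_eq
  intro s hs
  rw [Measure.map_apply hm (MeasurableSet.univ_pi hs)]
  have : (fun q : ℝ × ((ℝ × ℝ) × ℝ) => (![q.1, q.2.1.1, q.2.1.2, q.2.2] : Fin 4 → ℝ)) ⁻¹'
      (Set.univ.pi s) = s 0 ×ˢ ((s 1 ×ˢ s 2) ×ˢ s 3) := by
    ext q
    simp [Set.mem_pi, Fin.forall_fin_succ, and_assoc]
  rw [this]
  simp only [Measure.volume_eq_prod, Measure.prod_prod, Fin.prod_univ_four]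
  ring

lemma lintegral_pow_three :
    ∫⁻ n in Set.Ioo (0 : ℝ) 1, ENNReal.ofReal (n ^ 3) = ENNReal.ofReal (1 / 4) := by
  rw [← ofReal_integral_eq_lintegral_ofReal]
  · rw [← integral_Ioc_eq_integral_Ioo, ← intervalIntegral.integral_of_le zero_le_one,
      integral_pow]
    norm_num
  · exact ((continuous_pow 3).integrableOn_Icc (a := 0) (b := 1)).mono_set Set.Ioo_subset_Icc_self
  · filter_upwards [ae_restrict_mem measurableSet_Ioo] with n hn
    exact pow_nonneg hn.1.le 3

/-- The volume of the part of height at most one of the cone over a set. -/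
lemma volume_cone (T : Set ((ℝ × ℝ) × ℝ)) (S : Set (ℝ × ((ℝ × ℝ) × ℝ))) (hS : MeasurableSet S)
    (h : ∀ n w, (n, w) ∈ S ↔ 0 < n ∧ n < 1 ∧ n⁻¹ • w ∈ T) :
    volume S = ENNReal.ofReal (1 / 4) * volume T := by
  rw [Measure.volume_eq_prod, Measure.prod_apply hS, ← lintegral_pow_three,
    ← lintegral_mul_const _ (by fun_prop), ← lintegral_indicator measurableSet_Ioo]
  congr 1 with n
  by_cases hn : n ∈ Set.Ioo (0 : ℝ) 1
  · rw [Set.indicator_of_mem hn]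
    -- Slices are three-dimensional dilates, hence the factor `n ^ 3`, whose integral is `1 / 4`.
    have : Prod.mk n ⁻¹' S = n • T := by
      ext w
      rw [Set.mem_preimage, h, Set.mem_smul_set_iff_inv_smul_mem₀ hn.1.ne']
      simp [hn.1, hn.2]
    have : (volume : Measure (ℝ × ℝ)).IsAddHaarMeasure :=
      inferInstanceAs ((volume : Measure ℝ).prod (volume : Measure ℝ)).IsAddHaarMeasure
    have : (volume : Measure ((ℝ × ℝ) × ℝ)).IsAddHaarMeasure :=
      inferInstanceAs ((volume : Measure (ℝ × ℝ)).prod (volume : Measure ℝ)).IsAddHaarMeasure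
    rw [‹Prod.mk n ⁻¹' S = n • T›, Measure.addHaar_smul]
    simp [abs_of_pos hn.1]
  · rw [Set.indicator_of_notMem hn]
    have : Prod.mk n ⁻¹' S = ∅ := by
      ext w
      rw [Set.mem_preimage, h]
      simp only [Set.mem_Ioo] at hn
      simp only [Set.mem_empty_iff_false, iff_false]
      tauto
    rw [this, measure_empty]

/-- With two upper and two lower ends, the signed length is the least of the four differences; this
is the source of the four formulas for `g`. -/
lemma min_sub_max_zero (u v l : ℝ) :
    min u v - max 0 l = min (min u v) (min (v - l) (u - l)) := by
  rcases le_total u v with h | h <;> rcases le_total 0 l with h' | h' <;>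
    simp [h, h']

/-- The volume of the region of triples `(r, s, t)` above `B`, where `t` ranges over the admissible
weights of the largest eigenvalue. -/
lemma volume_regionBetween_weights (h₁₂ : a₁ < a₂) (h₂₃ : a₂ < a₃) (h₃₄ : a₃ < a₄)
    {B : Set (ℝ × ℝ)} (hB : MeasurableSet B) :
    volume (regionBetween
      (fun p : ℝ × ℝ => max 0 ((p.2 - chord a₁ a₃ p.1) / ((a₄ - a₁) * (a₄ - a₃))))
      (fun p : ℝ × ℝ => min ((p.2 - chord a₁ a₂ p.1) / ((a₄ - a₁) * (a₄ - a₂)))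
        ((p.2 - chord a₂ a₃ p.1) / ((a₄ - a₂) * (a₄ - a₃)))) B)
      = ∫⁻ p in B, ENNReal.ofReal
          (gMin a₁ a₂ a₃ a₄ p / ((a₄ - a₁) * (a₄ - a₂) * (a₄ - a₃))) := by
  have d₁ : 0 < a₄ - a₁ := by linarith
  have d₂ : 0 < a₄ - a₂ := by linarith
  have d₃ : 0 < a₄ - a₃ := by linarith
  rw [Measure.volume_eq_prod, volume_regionBetween_eq_lintegral _ _ hB]
  · congr 1 with p
    simp only [Pi.sub_apply, min_sub_max_zero]
    -- `ENNReal.ofReal` already truncates at zero, so the outer `max 0` disappears.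
    rw [gMin, ← max_div_div_right (by positivity), zero_div, ENNReal.ofReal_max,
      ENNReal.ofReal_zero, max_eq_right zero_le]
    simp only [← min_div_div_right (show
      0 ≤ (a₄ - a₁) * (a₄ - a₂) * (a₄ - a₃) by positivity)]
    have e₁ : (p.2 - chord a₁ a₂ p.1) / ((a₄ - a₁) * (a₄ - a₂))
        = (a₄ - a₃) * (p.2 - chord a₁ a₂ p.1) / ((a₄ - a₁) * (a₄ - a₂) * (a₄ - a₃)) := by
      field_simp
    have e₂ : (p.2 - chord a₂ a₃ p.1) / ((a₄ - a₂) * (a₄ - a₃))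
        = (a₄ - a₁) * (p.2 - chord a₂ a₃ p.1) / ((a₄ - a₁) * (a₄ - a₂) * (a₄ - a₃)) := by
      field_simp
    have e₃ : (p.2 - chord a₂ a₃ p.1) / ((a₄ - a₂) * (a₄ - a₃))
          - (p.2 - chord a₁ a₃ p.1) / ((a₄ - a₁) * (a₄ - a₃))
        = (a₂ - a₁) * (p.2 - chord a₃ a₄ p.1) / ((a₄ - a₁) * (a₄ - a₂) * (a₄ - a₃)) := by
      field_simp
      unfold chord
      ring
    have e₄ : (p.2 - chord a₁ a₂ p.1) / ((a₄ - a₁) * (a₄ - a₂))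
          - (p.2 - chord a₁ a₃ p.1) / ((a₄ - a₁) * (a₄ - a₃))
        = (a₂ - a₃) * (p.2 - chord a₁ a₄ p.1) / ((a₄ - a₁) * (a₄ - a₂) * (a₄ - a₃)) := by
      field_simp
      unfold chord
      ring
    rw [e₃, e₄, e₁, e₂]
  all_goals
    unfold chord
    fun_prop

/-! ### Change of variables from weights to moments -/

/-- The moment data `(∑ yᵢ, ∑ aᵢ yᵢ, ∑ aᵢ² yᵢ, y₄)` as a linear function of the weights. -/
def momentMatrix (a₁ a₂ a₃ a₄ : ℝ) : Matrix (Fin 4) (Fin 4) ℝ :=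
  !![1, 1, 1, 1; a₁, a₂, a₃, a₄; a₁ ^ 2, a₂ ^ 2, a₃ ^ 2, a₄ ^ 2; 0, 0, 0, 1]

lemma det_momentMatrix (a₁ a₂ a₃ a₄ : ℝ) :
    (momentMatrix a₁ a₂ a₃ a₄).det = (a₂ - a₁) * (a₃ - a₁) * (a₃ - a₂) := by
  simp [momentMatrix, Matrix.det_succ_row_zero, Fin.sum_univ_succ, Fin.succAbove]
  ring

/-- Weights `y` of total mass in `(0, 1)` whose normalised moments lie in `B`. -/
def momentSet (a : Fin 4 → ℝ) (B : Set (ℝ × ℝ)) : Set (Fin 4 → ℝ) :=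
  {y | 0 < ∑ i, y i ∧ ∑ i, y i < 1 ∧
    ((∑ i, a i * y i) / ∑ i, y i, (∑ i, a i ^ 2 * y i) / ∑ i, y i) ∈ B}

lemma measurableSet_momentSet (a : Fin 4 → ℝ) {B : Set (ℝ × ℝ)} (hB : MeasurableSet B) :
    MeasurableSet (momentSet a B) := by
  have h : Measurable fun y : Fin 4 → ℝ =>
      ((∑ i, a i * y i) / ∑ i, y i, (∑ i, a i ^ 2 * y i) / ∑ i, y i) := by fun_prop
  have h' : Measurable fun y : Fin 4 → ℝ => ∑ i, y i := by fun_prop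
  exact (measurableSet_lt measurable_const h').inter
    ((measurableSet_lt h' measurable_const).inter (h hB))

lemma volume_momentSet_inter (h₁₂ : a₁ < a₂) (h₂₃ : a₂ < a₃) (h₃₄ : a₃ < a₄)
    {B : Set (ℝ × ℝ)} (hB : MeasurableSet B) :
    volume (momentSet ![a₁, a₂, a₃, a₄] B ∩ Set.univ.pi fun _ => Set.Ioi 0)
      = ENNReal.ofReal (1 / 4) * ∫⁻ p in B, ENNReal.ofReal
          (gMin a₁ a₂ a₃ a₄ p / vandermonde4 a₁ a₂ a₃ a₄) := by
  have d₂₁ : 0 < a₂ - a₁ := by linarith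
  have d₃₁ : 0 < a₃ - a₁ := by linarith
  have d₃₂ : 0 < a₃ - a₂ := by linarith
  have d₁ : 0 < a₄ - a₁ := by linarith
  have d₂ : 0 < a₄ - a₂ := by linarith
  have d₃ : 0 < a₄ - a₃ := by linarith
  set T := regionBetween
      (fun p : ℝ × ℝ => max 0 ((p.2 - chord a₁ a₃ p.1) / ((a₄ - a₁) * (a₄ - a₃))))
      (fun p : ℝ × ℝ => min ((p.2 - chord a₁ a₂ p.1) / ((a₄ - a₁) * (a₄ - a₂)))
        ((p.2 - chord a₂ a₃ p.1) / ((a₄ - a₂) * (a₄ - a₃)))) B with hT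
  have hTm : MeasurableSet T := by
    apply measurableSet_regionBetween _ _ hB <;> (unfold chord; fun_prop)
  set P : Set (Fin 4 → ℝ) := {x | 0 < x 0 ∧ x 0 < 1 ∧
    (((x 0)⁻¹ * x 1, (x 0)⁻¹ * x 2), (x 0)⁻¹ * x 3) ∈ T} with hP
  have hPm : MeasurableSet P := by
    have h : Measurable fun x : Fin 4 → ℝ =>
      (((x 0)⁻¹ * x 1, (x 0)⁻¹ * x 2), (x 0)⁻¹ * x 3) := by fun_prop
    exact (measurableSet_lt measurable_const (measurable_pi_apply 0)).inter
      ((measurableSet_lt (measurable_pi_apply 0) measurable_const).inter (h hTm))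
  have hdet := det_momentMatrix a₁ a₂ a₃ a₄
  have hdet0 : (momentMatrix a₁ a₂ a₃ a₄).det ≠ 0 := by rw [hdet]; positivity
  have hpre : momentSet ![a₁, a₂, a₃, a₄] B ∩ (Set.univ.pi fun _ => Set.Ioi 0)
      = Matrix.toLin' (momentMatrix a₁ a₂ a₃ a₄) ⁻¹' P := by
    ext y
    have e : ∀ i, (momentMatrix a₁ a₂ a₃ a₄).mulVec y i = ![y 0 + y 1 + y 2 + y 3,
        a₁ * y 0 + a₂ * y 1 + a₃ * y 2 + a₄ * y 3,
        a₁ ^ 2 * y 0 + a₂ ^ 2 * y 1 + a₃ ^ 2 * y 2 + a₄ ^ 2 * y 3, y 3] i := by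
      intro i
      fin_cases i <;>
        simp [momentMatrix, Matrix.mulVec, dotProduct, Fin.sum_univ_four]
    simp only [momentSet, hP, hT, regionBetween, Set.mem_inter_iff, Set.mem_ofPred_eq,
      Set.mem_preimage, Matrix.toLin'_apply, e, Fin.sum_univ_four, Set.mem_pi, Set.mem_univ,
      true_imp_iff, Set.mem_Ioi, Fin.forall_fin_succ, Set.mem_Ioo, max_lt_iff, lt_min_iff]
    simp only [Matrix.cons_val, Fin.succ_zero_eq_one, Fin.succ_one_eq_two, IsEmpty.forall_iff,
      and_true, ← div_eq_inv_mul, Fin.reduceSucc]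
    rw [and_assoc]
    refine and_congr_right fun hN => ?_
    rw [and_assoc, and_congr_right_iff]
    intro _
    refine and_congr_right fun _ => ?_
    set N := y 0 + y 1 + y 2 + y 3 with hNdef
    -- `φᵢⱼ` interpolates the square at `aᵢ` and `aⱼ`, so weights `i` and `j` drop out: each gap
    -- between `t = y 3 / N` and its bound is a positive multiple of a single weight.
    have e₁ : y 3 / N - ((a₁ ^ 2 * y 0 + a₂ ^ 2 * y 1 + a₃ ^ 2 * y 2 + a₄ ^ 2 * y 3) / N
        - chord a₁ a₃ ((a₁ * y 0 + a₂ * y 1 + a₃ * y 2 + a₄ * y 3) / N))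
        / ((a₄ - a₁) * (a₄ - a₃))
        = (a₂ - a₁) * (a₃ - a₂) / (N * ((a₄ - a₁) * (a₄ - a₃))) * y 1 := by
      unfold chord
      field_simp
      rw [hNdef]
      ring
    have e₂ : ((a₁ ^ 2 * y 0 + a₂ ^ 2 * y 1 + a₃ ^ 2 * y 2 + a₄ ^ 2 * y 3) / N
        - chord a₁ a₂ ((a₁ * y 0 + a₂ * y 1 + a₃ * y 2 + a₄ * y 3) / N))
        / ((a₄ - a₁) * (a₄ - a₂)) - y 3 / N
        = (a₃ - a₁) * (a₃ - a₂) / (N * ((a₄ - a₁) * (a₄ - a₂))) * y 2 := by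
      unfold chord
      field_simp
      rw [hNdef]
      ring
    have e₃ : ((a₁ ^ 2 * y 0 + a₂ ^ 2 * y 1 + a₃ ^ 2 * y 2 + a₄ ^ 2 * y 3) / N
        - chord a₂ a₃ ((a₁ * y 0 + a₂ * y 1 + a₃ * y 2 + a₄ * y 3) / N))
        / ((a₄ - a₂) * (a₄ - a₃)) - y 3 / N
        = (a₂ - a₁) * (a₃ - a₁) / (N * ((a₄ - a₂) * (a₄ - a₃))) * y 0 := by
      unfold chord
      field_simp
      rw [hNdef]
      ring
    rw [div_pos_iff_of_pos_right hN, ← sub_pos (b := _ / ((a₄ - a₁) * (a₄ - a₃))), e₁,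
      ← sub_pos (b := y 3 / N), e₂, ← sub_pos (b := y 3 / N), e₃, mul_pos_iff_of_pos_left
      (by positivity), mul_pos_iff_of_pos_left (by positivity), mul_pos_iff_of_pos_left
      (by positivity)]
    tauto
  have hvol : volume P = ENNReal.ofReal (1 / 4) * volume T := by
    rw [← measurePreserving_vec4.measure_preimage hPm.nullMeasurableSet]
    apply volume_cone _ _ (measurePreserving_vec4.measurable hPm)
    intro n w
    simp only [hP, Set.mem_preimage, Set.mem_ofPred_eq]
    rfl
  rw [hpre, ← Measure.map_apply (LinearMap.continuous_of_finiteDimensional _).measurable hPm,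
    Real.map_matrix_volume_pi_eq_smul_volume_pi hdet0, Measure.smul_apply, hvol,
    volume_regionBetween_weights h₁₂ h₂₃ h₃₄ hB, smul_eq_mul, mul_left_comm,
    ← lintegral_const_mul' _ _ ENNReal.ofReal_ne_top]
  congr 3 with p
  -- The determinant supplies the three Vandermonde factors without `a₄`; the fibre length supplies
  -- the other three.
  rw [← ENNReal.ofReal_mul (abs_nonneg _), hdet, abs_of_pos (by positivity)]
  congr 1
  unfold vandermonde4
  field_simp

/-! ### Diagonalisation and reduction from the sphere to volumes -/

/-- A Hermitian matrix of size `d` with `d` distinct prescribed eigenvalues is diagonal, with these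
eigenvalues, in some orthonormal basis. -/
lemma exists_orthonormalBasis_of_hasEigenvalue {d : ℕ} [NeZero d] {A : Matrix (Fin d) (Fin d) ℂ}
    (hA : A.IsHermitian) {a : Fin d → ℝ} (ha : Function.Injective a)
    (hev : ∀ i, Module.End.HasEigenvalue (Matrix.toLin' A) (a i : ℂ)) :
    ∃ b : OrthonormalBasis (Fin d) ℂ (EuclideanSpace ℂ (Fin d)),
      ∀ i, Matrix.toEuclideanLin A (b i) = (a i : ℂ) • b i := by
  have hT := Matrix.isSymmetric_toEuclideanLin_iff.2 hA
  have hv : ∀ i, ∃ v : EuclideanSpace ℂ (Fin d), ‖v‖ = 1 ∧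
      Matrix.toEuclideanLin A v = (a i : ℂ) • v := by
    intro i
    obtain ⟨v, hv⟩ := (hev i).exists_hasEigenvector
    have h0 : WithLp.toLp 2 v ≠ 0 := by
      simpa using hv.2
    have h1 : Matrix.toEuclideanLin A (WithLp.toLp 2 v) = (a i : ℂ) • WithLp.toLp 2 v := by
      have := hv.apply_eq_smul
      rw [Matrix.toLin'_apply] at this
      rw [Matrix.toEuclideanLin, Matrix.toLpLin_toLp, Matrix.toLin'_apply, this, WithLp.toLp_smul]
    refine ⟨((‖WithLp.toLp 2 v‖⁻¹ : ℝ) : ℂ) • WithLp.toLp 2 v, ?_, ?_⟩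
    · rw [norm_smul]
      simp only [Complex.norm_real, norm_inv, norm_norm]
      exact inv_mul_cancel₀ (norm_ne_zero_iff.2 h0)
    · rw [map_smul, h1, smul_comm]
  choose v hv1 hv2 using hv
  have hon : Orthonormal ℂ v := by
    refine ⟨hv1, fun i j hij => ?_⟩
    have hne : (a i : ℂ) ≠ (a j : ℂ) := fun h => hij (ha (Complex.ofReal_injective h))
    exact hT.orthogonalFamily_eigenspaces hne
      (⟨v i, Module.End.mem_eigenspace_iff.2 (hv2 i)⟩ : Module.End.eigenspace _ (a i : ℂ))
      (⟨v j, Module.End.mem_eigenspace_iff.2 (hv2 j)⟩ : Module.End.eigenspace _ (a j : ℂ))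
  have hc := coe_basisOfOrthonormalOfCardEqFinrank hon (by simp)
  refine ⟨(basisOfOrthonormalOfCardEqFinrank hon (by simp)).toOrthonormalBasis
    (by rw [hc]; exact hon), fun i => ?_⟩
  rw [Module.Basis.coe_toOrthonormalBasis, hc, hv2]

lemma re_inner_toEuclideanLin {d : ℕ} {A : Matrix (Fin d) (Fin d) ℂ} (hA : A.IsHermitian)
    {a : Fin d → ℝ} (b : OrthonormalBasis (Fin d) ℂ (EuclideanSpace ℂ (Fin d)))
    (hb : ∀ i, Matrix.toEuclideanLin A (b i) = (a i : ℂ) • b i) (x : EuclideanSpace ℂ (Fin d)) :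
    (inner ℂ x (Matrix.toEuclideanLin A x)).re = ∑ i, a i * ‖b.repr x i‖ ^ 2 := by
  have hT := Matrix.isSymmetric_toEuclideanLin_iff.2 hA
  rw [← b.sum_inner_mul_inner, Complex.re_sum]
  refine Finset.sum_congr rfl fun i _ => ?_
  rw [← hT, hb, inner_smul_left, Complex.conj_ofReal, mul_left_comm, Complex.re_ofReal_mul,
    b.repr_apply_apply]
  congr 1
  refine (inner_mul_symm_re_eq_norm (𝕜 := ℂ) x (b i)).trans ?_
  rw [norm_mul, norm_inner_symm x, pow_two]

lemma toEuclideanLin_sq_apply {d : ℕ} {A : Matrix (Fin d) (Fin d) ℂ} {a : ℝ}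
    {v : EuclideanSpace ℂ (Fin d)} (h : Matrix.toEuclideanLin A v = (a : ℂ) • v) :
    Matrix.toEuclideanLin (A ^ 2) v = ((a ^ 2 : ℝ) : ℂ) • v := by
  have : Matrix.toEuclideanLin (A ^ 2) v
      = Matrix.toEuclideanLin A (Matrix.toEuclideanLin A v) := by
    simp [Matrix.toEuclideanLin, Matrix.toLpLin_apply, pow_two]
  rw [this, h, map_smul, h, smul_smul]
  congr 1
  push_cast
  ring

lemma expPair_eq {d : ℕ} {A : Matrix (Fin d) (Fin d) ℂ} (hA : A.IsHermitian)
    {a : Fin d → ℝ} (b : OrthonormalBasis (Fin d) ℂ (EuclideanSpace ℂ (Fin d)))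
    (hb : ∀ i, Matrix.toEuclideanLin A (b i) = (a i : ℂ) • b i) (ψ : PureState d) :
    expPair A ψ = (∑ i, a i * ‖b.repr ψ i‖ ^ 2, ∑ i, a i ^ 2 * ‖b.repr ψ i‖ ^ 2) :=
  Prod.ext (re_inner_toEuclideanLin hA b hb ψ)
    (re_inner_toEuclideanLin (a := fun i => a i ^ 2) (hA.pow 2) b
      (fun i => toEuclideanLin_sq_apply (hb i)) ψ)

lemma measurable_expPair {d : ℕ} (A : Matrix (Fin d) (Fin d) ℂ) : Measurable (expPair A) := by
  have h : ∀ M : Matrix (Fin d) (Fin d) ℂ, Continuous (expVal M) := fun M => by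
    unfold expVal
    have := (Matrix.toEuclideanLin M).continuous_of_finiteDimensional
    fun_prop
  exact ((h A).prodMk (h (A ^ 2))).measurable

/-- The truncated cone over a level set of `expPair`, in coordinates. -/
lemma Ioo_smul_expPair_preimage {A : Matrix (Fin 4) (Fin 4) ℂ} (hA : A.IsHermitian)
    {a : Fin 4 → ℝ} (b : OrthonormalBasis (Fin 4) ℂ (EuclideanSpace ℂ (Fin 4)))
    (hb : ∀ i, Matrix.toEuclideanLin A (b i) = (a i : ℂ) • b i) (B : Set (ℝ × ℝ)) :
    Set.Ioo (0 : ℝ) 1 • (Subtype.val '' (expPair A ⁻¹' B))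
      = {x : EuclideanSpace ℂ (Fin 4) | (fun i => ‖b.repr x i‖ ^ 2) ∈ momentSet a B} := by
  have hN : ∀ x, ∑ i, ‖b.repr x i‖ ^ 2 = ‖x‖ ^ 2 := by
    intro x
    rw [← b.repr.norm_map x, EuclideanSpace.norm_sq_eq]
  -- All moments are homogeneous of degree two, so their ratios to the mass are constant along rays.
  have hs : ∀ (c : Fin 4 → ℝ) (ρ : ℝ) (x : EuclideanSpace ℂ (Fin 4)),
      ∑ i, c i * ‖b.repr (ρ • x) i‖ ^ 2 = ρ ^ 2 * ∑ i, c i * ‖b.repr x i‖ ^ 2 := by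
    intro c ρ x
    rw [Finset.mul_sum]
    refine Finset.sum_congr rfl fun i _ => ?_
    rw [← Complex.coe_smul, map_smul, PiLp.smul_apply, norm_smul, Complex.norm_real, mul_pow,
      Real.norm_eq_abs, sq_abs]
    ring
  ext x
  simp only [Set.mem_smul, Set.mem_image, Set.mem_preimage, momentSet, Set.mem_ofPred_eq, hN]
  constructor
  · rintro ⟨ρ, hρ, _, ⟨ψ, hψ, rfl⟩, rfl⟩
    have hn : ‖ρ • (ψ : EuclideanSpace ℂ (Fin 4))‖ = ρ := by
      rw [norm_smul, norm_eq_of_mem_sphere, mul_one, Real.norm_of_nonneg hρ.1.le]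
    rw [hn, hs, hs (fun i => a i ^ 2), mul_div_cancel_left₀ _ (pow_pos hρ.1 2).ne',
      mul_div_cancel_left₀ _ (pow_pos hρ.1 2).ne', ← expPair_eq hA b hb]
    exact ⟨pow_pos hρ.1 2, pow_lt_one₀ hρ.1.le hρ.2 two_ne_zero, hψ⟩
  · rintro ⟨h0, h1, h⟩
    have hx : 0 < ‖x‖ := (norm_nonneg x).lt_of_ne' (by rintro h'; simp [h'] at h0)
    have hx1 : ‖x‖ < 1 := by nlinarith
    have hu : ‖x‖⁻¹ • x ∈ Metric.sphere (0 : EuclideanSpace ℂ (Fin 4)) 1 := by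
      rw [mem_sphere_zero_iff_norm, norm_smul, norm_inv, norm_norm, inv_mul_cancel₀ hx.ne']
    refine ⟨‖x‖, ⟨hx, hx1⟩, ‖x‖⁻¹ • x, ⟨⟨_, hu⟩, ?_, rfl⟩, ?_⟩
    · rw [expPair_eq hA b hb, hs, hs (fun i => a i ^ 2), inv_pow, ← div_eq_inv_mul,
        ← div_eq_inv_mul]
      exact h
    · exact smul_inv_smul₀ hx.ne' x

/-- The normalised surface measure, in terms of volumes in the coordinates of any orthonormal
basis. -/
lemma haarPureState_expPair_preimage {A : Matrix (Fin 4) (Fin 4) ℂ} (hA : A.IsHermitian)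
    {a : Fin 4 → ℝ} (b : OrthonormalBasis (Fin 4) ℂ (EuclideanSpace ℂ (Fin 4)))
    (hb : ∀ i, Matrix.toEuclideanLin A (b i) = (a i : ℂ) • b i) {B : Set (ℝ × ℝ)}
    (hB : MeasurableSet B) :
    haarPureState 4 (expPair A ⁻¹' B)
      = (volume {z : Fin 4 → ℂ | (fun i => ‖z i‖ ^ 2) ∈ momentSet a Set.univ})⁻¹ *
        volume {z : Fin 4 → ℂ | (fun i => ‖z i‖ ^ 2) ∈ momentSet a B} := by
  let L : EuclideanSpace ℂ (Fin 4) ≃L[ℝ] (Fin 4 → ℂ) :=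
    ((b.repr.toLinearEquiv.trans
      (WithLp.linearEquiv 2 ℂ (Fin 4 → ℂ))).restrictScalars ℝ).toContinuousLinearEquiv
  have hhaar : ((volume : Measure (EuclideanSpace ℂ (Fin 4))).map L).IsAddHaarMeasure :=
    L.isAddHaarMeasure_map _
  -- Uniqueness of Haar measure gives some scaling constant `c`; it cancels on normalising, as does
  -- the real dimension `8` from the cone formula, so its value is not needed.
  obtain ⟨c, hc0, hc⟩ : ∃ c : NNReal, 0 < c ∧
      (volume : Measure (EuclideanSpace ℂ (Fin 4))).map L = c • volume :=
    ⟨_, Measure.addHaarScalarFactor_pos_of_isAddHaarMeasure _ _,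
      Measure.isAddLeftInvariant_eq_smul _ _⟩
  have key : ∀ B : Set (ℝ × ℝ), MeasurableSet B →
      (volume : Measure (EuclideanSpace ℂ (Fin 4))).toSphere (expPair A ⁻¹' B)
      = 8 * c * volume {z : Fin 4 → ℂ | (fun i => ‖z i‖ ^ 2) ∈ momentSet a B} := by
    intro B hB
    have hm : MeasurableSet {z : Fin 4 → ℂ | (fun i => ‖z i‖ ^ 2) ∈ momentSet a B} := by
      have h : Measurable fun (z : Fin 4 → ℂ) i => ‖z i‖ ^ 2 := by fun_prop
      exact h (measurableSet_momentSet a hB)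
    have hd : Module.finrank ℝ (EuclideanSpace ℂ (Fin 4)) = 8 := by
      rw [← Module.finrank_mul_finrank ℝ ℂ]
      simp
    rw [Measure.toSphere_apply' _ (measurable_expPair A hB), Ioo_smul_expPair_preimage hA b hb, hd,
      mul_assoc, ← smul_eq_mul (a := (c : ℝ≥0∞)), ← ENNReal.smul_def, ← Measure.smul_apply, ← hc,
      Measure.map_apply L.continuous.measurable hm]
    rfl
  rw [haarPureState, Measure.smul_apply, key B hB, ← Set.preimage_univ (f := expPair A),
    key _ MeasurableSet.univ, smul_eq_mul,
    ENNReal.mul_inv (Or.inl (by simp [hc0.ne'])) (Or.inl (by finiteness)),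
    mul_assoc, mul_left_comm, ← mul_assoc (8 * (c : ℝ≥0∞))⁻¹, ENNReal.inv_mul_cancel, one_mul]
  · simp [hc0.ne']
  · finiteness

/-! ### Normalisation and the law of the pair -/

lemma volume_norm_sq_mem_momentSet (a : Fin 4 → ℝ) {B : Set (ℝ × ℝ)} (hB : MeasurableSet B) :
    volume {z : Fin 4 → ℂ | (fun i => ‖z i‖ ^ 2) ∈ momentSet a B}
      = ENNReal.ofReal (Real.pi ^ 4) *
        volume (momentSet a B ∩ Set.univ.pi fun _ => Set.Ioi 0) := by
  have h : Measurable fun (z : Fin 4 → ℂ) i => ‖z i‖ ^ 2 := by fun_prop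
  have hm := measurableSet_momentSet a hB
  have := Measure.map_apply (μ := volume) h hm
  rw [map_norm_sq_volume_pi, Measure.smul_apply, Measure.restrict_apply hm] at this
  rw [ENNReal.ofReal_pow Real.pi_pos.le]
  refine this.symm.trans ?_
  rw [ENNReal.smul_def, smul_eq_mul, ENNReal.coe_pow, ← NNReal.coe_real_pi,
    ENNReal.ofReal_coe_nnreal]

/-- The set is the open unit ball of `ℂ⁴` without the origin, which is null; `24` is `Γ(5) = 4!`. -/
lemma volume_norm_sq_mem_momentSet_univ (a : Fin 4 → ℝ) :
    volume {z : Fin 4 → ℂ | (fun i => ‖z i‖ ^ 2) ∈ momentSet a Set.univ}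
      = ENNReal.ofReal (Real.pi ^ 4 / 24) := by
  have h := Complex.volume_sum_rpow_lt_one (Fin 4) (p := 2) one_le_two
  have e : {z : Fin 4 → ℂ | (fun i => ‖z i‖ ^ 2) ∈ momentSet a Set.univ}
      = {z | ∑ i, ‖z i‖ ^ (2 : ℝ) < 1} \ {0} := by
    ext z
    have h0 : 0 ≤ ∑ i, ‖z i‖ ^ 2 := Finset.sum_nonneg fun i _ => by positivity
    have : 0 < ∑ i, ‖z i‖ ^ 2 ↔ z ≠ 0 := by
      rw [h0.lt_iff_ne', not_iff_not, Finset.sum_eq_zero_iff_of_nonneg fun i _ => by positivity]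
      simp [funext_iff]
    simp only [momentSet, Set.mem_ofPred_eq, Set.mem_univ, and_true, Set.mem_sdiff,
      Set.mem_singleton_iff, Real.rpow_two, this]
    tauto
  rw [e, measure_sdiff_null (measure_singleton _), h]
  congr 1
  have g5 : Real.Gamma 5 = 24 := by
    have := Real.Gamma_nat_eq_factorial 4
    rw [show ((4 : ℕ) : ℝ) + 1 = 5 by norm_num] at this
    rw [this]
    norm_num [Nat.factorial]
  norm_num [g5]

/-- The law of `expPair A`. -/
lemma map_expPair {A : Matrix (Fin 4) (Fin 4) ℂ} (hA : A.IsHermitian) {a₁ a₂ a₃ a₄ : ℝ}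
    (h₁₂ : a₁ < a₂) (h₂₃ : a₂ < a₃) (h₃₄ : a₃ < a₄)
    (hev : ∀ x ∈ ({a₁, a₂, a₃, a₄} : Set ℝ),
      Module.End.HasEigenvalue (Matrix.toLin' A) (x : ℂ)) :
    (haarPureState 4).map (expPair A)
      = volume.withDensity fun p => ENNReal.ofReal (jointDensity a₁ a₂ a₃ a₄ p) := by
  have hmono : StrictMono ![a₁, a₂, a₃, a₄] := by
    rw [Fin.strictMono_iff_lt_succ]
    intro i
    fin_cases i <;> simpa
  obtain ⟨b, hb⟩ := exists_orthonormalBasis_of_hasEigenvalue hA hmono.injective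
    (fun i => hev _ (by fin_cases i <;> simp))
  ext B hB
  have hV := vandermonde4_pos h₁₂ h₂₃ h₃₄
  rw [Measure.map_apply (measurable_expPair A) hB, withDensity_apply _ hB,
    haarPureState_expPair_preimage hA b hb hB, volume_norm_sq_mem_momentSet_univ,
    volume_norm_sq_mem_momentSet _ hB, volume_momentSet_inter h₁₂ h₂₃ h₃₄ hB,
    ← ENNReal.ofReal_inv_of_pos (by positivity), ← mul_assoc, ← mul_assoc,
    ← ENNReal.ofReal_mul (by positivity), ← ENNReal.ofReal_mul (by positivity),
    ← lintegral_const_mul' _ _ ENNReal.ofReal_ne_top]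
  congr 1 with p
  -- The constant `6` is `(π⁴ / 24)⁻¹ · π⁴ · (1 / 4)`.
  rw [← ENNReal.ofReal_mul (by positivity), jointDensity, g_eq_gMin h₁₂ h₂₃ h₃₄]
  congr 1
  field_simp
  ring

end QuditPDF

end

theorem mainTheorem7 (A : Matrix (Fin 4) (Fin 4) ℂ) (hA : A.IsHermitian)
    (a₁ a₂ a₃ a₄ : ℝ) (h₁₂ : a₁ < a₂) (h₂₃ : a₂ < a₃) (h₃₄ : a₃ < a₄)
    (hev : ∀ x ∈ ({a₁, a₂, a₃, a₄} : Set ℝ),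
      Module.End.HasEigenvalue (Matrix.toLin' A) (x : ℂ)) :
    -- `(⟨A⟩, ⟨A ^ 2⟩)` has a joint density, namely `jointDensity`
    HasPDF (QuditPDF.expPair A) (QuditPDF.haarPureState 4) (volume : Measure (ℝ × ℝ)) ∧
    pdf (QuditPDF.expPair A) (QuditPDF.haarPureState 4) (volume : Measure (ℝ × ℝ))
      =ᵐ[volume] (fun p => ENNReal.ofReal (QuditPDF.jointDensity a₁ a₂ a₃ a₄ p)) ∧
    (∀ p, 0 ≤ QuditPDF.jointDensity a₁ a₂ a₃ a₄ p) ∧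
    -- the four formulas hold on the whole closed pieces (so the definition by cases is consistent)
    (∀ p ∈ QuditPDF.piece12 a₁ a₂ a₃ a₄,
      QuditPDF.g a₁ a₂ a₃ a₄ p = (a₄ - a₃) * (p.2 - QuditPDF.chord a₁ a₂ p.1)) ∧
    (∀ p ∈ QuditPDF.piece23 a₁ a₂ a₃ a₄,
      QuditPDF.g a₁ a₂ a₃ a₄ p = (a₄ - a₁) * (p.2 - QuditPDF.chord a₂ a₃ p.1)) ∧
    (∀ p ∈ QuditPDF.piece34 a₁ a₂ a₃ a₄,
      QuditPDF.g a₁ a₂ a₃ a₄ p = (a₂ - a₁) * (p.2 - QuditPDF.chord a₃ a₄ p.1)) ∧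
    (∀ p ∈ QuditPDF.piece14 a₁ a₂ a₃ a₄,
      QuditPDF.g a₁ a₂ a₃ a₄ p = (a₂ - a₃) * (p.2 - QuditPDF.chord a₁ a₄ p.1)) ∧
    -- the density vanishes outside the ten regions
    (∀ p, p ∉ QuditPDF.piece12 a₁ a₂ a₃ a₄ ∪ QuditPDF.piece23 a₁ a₂ a₃ a₄ ∪
        QuditPDF.piece34 a₁ a₂ a₃ a₄ ∪ QuditPDF.piece14 a₁ a₂ a₃ a₄ →
      QuditPDF.jointDensity a₁ a₂ a₃ a₄ p = 0) := by
  have hg := QuditPDF.g_eq_gMin h₁₂ h₂₃ h₃₄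
  have hmap := QuditPDF.map_expPair hA h₁₂ h₂₃ h₃₄ hev
  have hX := (QuditPDF.measurable_expPair A).aemeasurable (μ := QuditPDF.haarPureState 4)
  have hmeas : AEMeasurable (fun p => ENNReal.ofReal (QuditPDF.jointDensity a₁ a₂ a₃ a₄ p))
      (volume : Measure (ℝ × ℝ)) := by
    -- Measurability is read off the max-min form, with no case distinction over regions.
    unfold QuditPDF.jointDensity
    rw [hg]
    unfold QuditPDF.gMin QuditPDF.chord
    fun_prop
  have hpdf := hasPDF_of_map_eq_withDensity hX _ hmeas hmap
  refine ⟨hpdf, (pdf.eq_of_map_eq_withDensity' _ hmeas).1 hmap, fun p => ?_, ?_, ?_, ?_, ?_,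
    fun p hp => ?_⟩
  · rw [QuditPDF.jointDensity, hg]
    exact mul_nonneg (div_nonneg (by norm_num) (QuditPDF.vandermonde4_pos h₁₂ h₂₃ h₃₄).le)
      (le_max_left _ _)
  · rw [hg]
    exact fun p hp => QuditPDF.gMin_of_mem_piece12 h₁₂ h₂₃ h₃₄ hp
  · rw [hg]
    exact fun p hp => QuditPDF.gMin_of_mem_piece23 h₁₂ h₂₃ h₃₄ hp
  · rw [hg]
    exact fun p hp => QuditPDF.gMin_of_mem_piece34 h₁₂ h₂₃ h₃₄ hp
  · rw [hg]
    exact fun p hp => QuditPDF.gMin_of_mem_piece14 h₁₂ h₂₃ h₃₄ hp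
  · simp only [Set.mem_union, not_or] at hp
    rw [QuditPDF.jointDensity, hg, QuditPDF.gMin_of_notMem h₁₂ h₂₃ h₃₄ hp.1.1.1 hp.1.1.2 hp.1.2
      hp.2, mul_zero]
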